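/- **Theorem (Parseval identity).** Let $g=\sum_{i=1}^n g_i\,\delta_{\xi_i}$ with $g_i>0$ and $0<\xi_1<\dots<\xi_n\le 1$ (a discrete cubic string; the case $\xi_n=1$ is called degenerate). Differential equations involving $g$ are understood in the sense of distributions, with $\phi,\phi_\xi$ continuous and $\phi_{\xi\xi}$ right-continuous; in the degenerate case derivatives at $1$ are right-hand limits. Put $(f,h)_g=\int fh\,dg$ (bilinear) for $f,h\in L^2_g=L^2([0,1],g)$ (complex valued). For $z\in\mathbb C$ let $\phi(\xi;z)$ be the solution of $-\phi_{\xi\xi\xi}=z g\phi$, $\phi(0)=\phi_\xi(0)=0$, $\phi_{\xi\xi}(0)=1$. For $a=0,1,2$ let $\phi_a^*(\xi;z)$ be the solution of $\phi^*_{\xi\xi\xi}=zg\phi^*$ with $(\phi^*,\phi^*_\xi,\phi^*_{\xi\xi})(1)$ equal to $(0,0,1)$, $(0,1,0)$, $(1,0,0)$ respectively. The spectrum of type $a$ is the set of $z\in\mathbb C$ for which $-\phi_{\xi\xi\xi}=zg\phi$, $\phi(0)=\phi_\xi(0)=0$ has a nonzero solution on $[0,1]$ with $\phi(1)=0$ ($a=0$),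 $\phi_\xi(1)=0$ ($a=1$), $\phi_{\xi\xi}(1)=0$ ($a=2$). The Weyl functions are $$W_0=\frac{\phi_\xi(1;z)}{\phi(1;z)},\quad Z_0=\frac{\phi_{\xi\xi}(1;z)}{\phi(1;z)},\quad W_1=-\frac{\phi(1;z)}{\phi_\xi(1;z)},\quad Z_1=\frac{\phi_{\xi\xi}(1;z)}{\phi_\xi(1;z)},\quad W_2=-\frac{\phi_\xi(1;z)}{\phi_{\xi\xi}(1;z)},\quad Z_2=-\frac{\phi(1;z)}{\phi_{\xi\xi}(1;z)} .$$ Let $(a,b)$ be one of $(0,0),(0,1),(1,2),(2,2)$ (only $(2,2)$ in the degenerate case), and let $(M,N)$ be correspondingly $(W_0,W_0)$, $(Z_0,W_1)$, $(Z_1,Z_2)$, $(W_2,W_2)$. Then the spectra of types $a$ and $b$ are finite sets of positive real numbers, $M$ (resp. $N$) has a simple pole with positive residue at each point of the spectrum of type $a$ (resp. $b$), and for the positive discrete measures $$d\alpha=\sum_{x\in\text{spectrum of type }a}\operatorname{Res}_x M\;\delta_x,\qquad d\beta=\sum_{y\in\text{spectrum of type }b}\operatorname{Res}_y N\;\delta_y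 ,$$ the Cauchy pairing $\langle p|q\rangle=\iint\frac{p(x)q(y)}{x+y}\,d\alpha(x)\,d\beta(y)$ and the generalized Fourier transforms $\hat f_a(z)=(-1)^a\int\phi_a^*(\xi;z)f(\xi)\,dg(\xi)$, one has, for all $f,h\in L^2_g$, $$(f,h)_g=\langle\hat f_a|\hat h_b\rangle=\langle\hat h_a|\hat f_b\rangle .$$ -/

import Mathlib

open MeasureTheory Filter Topology Set

/-- The data of a discrete cubic string: finitely many positive point masses at positions
`0 < ξ₁ < ⋯ < ξₙ ≤ 1`.  The value `ξₙ = 1` is the degenerate case. -/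
structure DiscreteCubicString where
  /-- the number of point masses -/
  n : ℕ
  /-- the positions of the masses -/
  pos : Fin n → ℝ
  /-- the weights of the masses -/
  wt : Fin n → ℝ
  strictMono_pos : StrictMono pos
  pos_pos : ∀ i, 0 < pos i
  pos_le_one : ∀ i, pos i ≤ 1
  wt_pos : ∀ i, 0 < wt i

namespace DiscreteCubicString

variable (S : DiscreteCubicString)

/-- The nondegenerate case: all masses lie in the open interval `(0, 1)`. -/
def Nondegenerate : Prop := ∀ i, S.pos i < 1

/-- The mass distribution `g = ∑ gᵢ δ_{ξᵢ}`. -/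
noncomputable def mass : Measure ℝ :=
  ∑ i, ENNReal.ofReal (S.wt i) • Measure.dirac (S.pos i)

/-- `S.IsSolution c F` says that `f = F 0` solves `f_{ξξξ} = c g f` on the string, where
`F 1 = f_ξ` and `F 2 = f_{ξξ}`.  Since `g` is a measure, `f_{ξξ}` is a step function; it is
normalized to be right-continuous, so that it jumps by `c gᵢ f(ξᵢ)` at `ξᵢ`.
In particular the values at `1` are the right-hand limits if there is a mass at `1`. -/
structure IsSolution (c : ℂ) (F : Fin 3 → ℝ → ℂ) : Prop where
  eq_zero : ∀ x ∈ Icc (0 : ℝ) 1, F 0 x = F 0 0 + ∫ t in (0 : ℝ)..x, F 1 t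
  eq_one : ∀ x ∈ Icc (0 : ℝ) 1, F 1 x = F 1 0 + ∫ t in (0 : ℝ)..x, F 2 t
  eq_two : ∀ x ∈ Icc (0 : ℝ) 1, F 2 x = F 2 0 + c * ∫ t in Ioc (0 : ℝ) x, F 0 t ∂S.mass

/-! ### Existence of solutions of the initial value problems -/

theorem setIntegral_mass (f : ℝ → ℂ) (x : ℝ) :
    ∫ t in Ioc (0 : ℝ) x, f t ∂S.mass
      = ∑ i, if S.pos i ≤ x then (S.wt i : ℂ) * f (S.pos i) else 0 := by
  rw [← integral_indicator measurableSet_Ioc, mass, integral_finsetSum_measure]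
  · refine Finset.sum_congr rfl fun i _ => ?_
    rw [integral_smul_measure, integral_dirac, ENNReal.toReal_ofReal (S.wt_pos i).le]
    by_cases h : S.pos i ≤ x
    · simp [h, S.pos_pos i]
    · simp [h]
  · intro i _
    exact (integrable_dirac (by simp)).smul_measure ENNReal.ofReal_ne_top

theorem exists_triangular {ι : Type*} [Fintype ι] (r : ι → ι → Prop) [DecidableRel r]
    (hr : WellFounded r) (p : ι → ℂ) (W : ι → ι → ℂ) :
    ∃ y : ι → ℂ, ∀ k, y k = p k + ∑ i, if r i k then W k i * y i else 0 := by
  refine ⟨hr.fix fun k y => p k + ∑ i, if h : r i k then W k i * y i h else 0, fun k => ?_⟩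
  rw [hr.fix_eq]
  simp

/-- The positive part of `x` as a complex number. -/
noncomputable def ramp (x : ℝ) : ℂ := ((max x 0 : ℝ) : ℂ)

/-- The right-continuous indicator of `x ≥ 0`. -/
noncomputable def step (x : ℝ) : ℂ := if 0 ≤ x then 1 else 0

theorem hasDerivWithinAt_ramp (x : ℝ) : HasDerivWithinAt ramp (step x) (Ioi x) x := by
  by_cases h : 0 ≤ x
  · have h1 : HasDerivWithinAt (fun y : ℝ => (y : ℂ)) 1 (Ioi x) x :=
      (Complex.ofRealCLM.hasDerivAt (x := x)).hasDerivWithinAt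
    have : step x = 1 := by simp [step, h]
    rw [this]
    refine h1.congr (fun y hy => ?_) ?_
    · simp only [ramp]; rw [max_eq_left (h.trans (le_of_lt hy))]
    · simp only [ramp]; rw [max_eq_left h]
  · have : step x = 0 := by simp [step, h]
    rw [this]
    push Not at h
    refine HasDerivAt.hasDerivWithinAt ?_
    refine (hasDerivAt_const x (0 : ℂ)).congr_of_eventuallyEq ?_
    filter_upwards [Iio_mem_nhds h] with y hy
    simp [ramp, max_eq_right (le_of_lt (show y < 0 from hy))]

theorem continuous_ramp : Continuous ramp := by
  unfold ramp; fun_prop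

theorem hasDerivAt_ramp_sq (x : ℝ) : HasDerivAt (fun y => ramp y ^ 2 / 2) (ramp x) x := by
  rcases lt_trichotomy x 0 with h | h | h
  · have : ramp x = 0 := by simp [ramp, h.le]
    rw [this]
    refine (hasDerivAt_const x (0 : ℂ)).congr_of_eventuallyEq ?_
    filter_upwards [Iio_mem_nhds h] with y hy
    simp [ramp, max_eq_right (le_of_lt (show y < 0 from hy))]
  · subst h
    have h0 : ramp 0 = 0 := by simp [ramp]
    rw [h0, hasDerivAt_iff_isLittleO]
    simp only [h0, sub_zero, smul_zero]
    have : (fun y : ℝ => ramp y ^ 2 / 2) =O[𝓝 0] fun y : ℝ => y ^ 2 := by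
      refine Asymptotics.IsBigO.of_bound 1 (Eventually.of_forall fun y => ?_)
      have hb : |max y 0| ≤ |y| := by
        rcases le_total y 0 with hy | hy <;> simp [hy]
      have hb2 : |max y 0| ^ 2 ≤ |y| ^ 2 := pow_le_pow_left₀ (abs_nonneg _) hb 2
      simp only [ramp, norm_div, norm_pow, Complex.norm_real, Real.norm_eq_abs, one_mul]
      have h2 : ‖(2 : ℂ)‖ = 2 := by simp
      rw [h2]
      nlinarith [sq_nonneg |max y 0|]
    have h3 : (fun y : ℝ => y ^ 2) =o[𝓝 0] fun y : ℝ => y := by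
      simpa using Asymptotics.isLittleO_pow_pow (𝕜 := ℝ) (m := 1) (n := 2) (by norm_num)
    simpa using this.trans_isLittleO h3
  · have h1 : HasDerivAt (fun y : ℝ => (y : ℂ)) 1 x := Complex.ofRealCLM.hasDerivAt (x := x)
    have h2 := (h1.pow 2).div_const 2
    have : ramp x = (x : ℂ) := by simp [ramp, h.le]
    rw [this]
    refine (h2.congr_deriv (by push_cast; ring)).congr_of_eventuallyEq ?_
    filter_upwards [Ioi_mem_nhds h] with y hy
    simp [ramp, max_eq_left (le_of_lt (show 0 < y from hy))]

theorem measurable_step : Measurable step := by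
  unfold step
  exact Measurable.ite measurableSet_Ici measurable_const measurable_const

theorem norm_step_le (x : ℝ) : ‖step x‖ ≤ 1 := by
  unfold step; split_ifs <;> simp

/-- Piecewise quadratic functions with right-continuous second derivative, whose third
derivative is `c g f`, solve the equation. -/
theorem isSolution_ansatz (c p₀ p₁ p₂ : ℂ) (y : Fin S.n → ℂ)
    (hy : ∀ k, y k = p₀ + p₁ * S.pos k + p₂ * ((S.pos k : ℂ) ^ 2 / 2)
      + ∑ i, c * S.wt i * y i * (ramp (S.pos k - S.pos i) ^ 2 / 2)) :
    S.IsSolution c ![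
      fun x => p₀ + p₁ * x + p₂ * ((x : ℂ) ^ 2 / 2)
        + ∑ i, c * S.wt i * y i * (ramp (x - S.pos i) ^ 2 / 2),
      fun x => p₁ + p₂ * x + ∑ i, c * S.wt i * y i * ramp (x - S.pos i),
      fun x => p₂ + ∑ i, c * S.wt i * y i * step (x - S.pos i)] := by
  have hid : ∀ x : ℝ, HasDerivAt (fun y : ℝ => (y : ℂ)) 1 x :=
    fun x => Complex.ofRealCLM.hasDerivAt (x := x)
  have hstep : ∀ i, step (0 - S.pos i) = 0 := fun i => by
    have := S.pos_pos i
    simp [step, this]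
  refine ⟨fun x _ => ?_, fun x _ => ?_, fun x hx => ?_⟩
  · simp only [Matrix.cons_val]
    rw [intervalIntegral.integral_eq_sub_of_hasDerivAt
      (f := fun x : ℝ => p₀ + p₁ * x + p₂ * ((x : ℂ) ^ 2 / 2)
        + ∑ i, c * S.wt i * y i * (ramp (x - S.pos i) ^ 2 / 2))]
    · ring
    · intro t _
      have h1 := (((hid t).const_mul p₁).const_add p₀).add
        ((((hid t).pow 2).div_const 2).const_mul p₂)
      have h2 : HasDerivAt (fun x => ∑ i, c * S.wt i * y i * (ramp (x - S.pos i) ^ 2 / 2))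
          (∑ i, c * S.wt i * y i * ramp (t - S.pos i)) t :=
        HasDerivAt.fun_sum fun i _ =>
          ((hasDerivAt_ramp_sq (t - S.pos i)).comp_sub_const t (S.pos i)).const_mul _
      exact (h1.add h2).congr_deriv (by push_cast; ring)
    · refine Continuous.intervalIntegrable ?_ _ _
      have := continuous_ramp
      fun_prop
  · simp only [Matrix.cons_val]
    rw [intervalIntegral.integral_eq_sub_of_hasDeriv_right
      (f := fun x : ℝ => p₁ + p₂ * x + ∑ i, c * S.wt i * y i * ramp (x - S.pos i))]
    · ring
    · have := continuous_ramp
      fun_prop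
    · intro t _
      have h1 := (((hid t).const_mul p₂).const_add p₁).hasDerivWithinAt (s := Ioi t)
      have h2 : HasDerivWithinAt (fun x => ∑ i, c * S.wt i * y i * ramp (x - S.pos i))
          (∑ i, c * S.wt i * y i * step (t - S.pos i)) (Ioi t) t := by
        refine HasDerivWithinAt.fun_sum fun i _ => HasDerivWithinAt.const_mul _ ?_
        have h3 := (hasDerivWithinAt_ramp (t - S.pos i)).scomp t
          (((hasDerivAt_id t).sub_const (S.pos i)).hasDerivWithinAt (s := Ioi t))
          (fun u hu => by simpa using hu)
        simpa [Function.comp_def] using h3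
      exact (h1.add h2).congr_deriv (by ring)
    · refine (intervalIntegrable_const).add ?_
      have hsum : (fun x => ∑ i, c * S.wt i * y i * step (x - S.pos i))
          = ∑ i, fun x => c * S.wt i * y i * step (x - S.pos i) := by
        ext u; simp
      rw [hsum]
      refine IntervalIntegrable.sum _ fun i _ => IntervalIntegrable.const_mul ?_ _
      refine (intervalIntegrable_const (c := (1 : ℝ))).mono_fun ?_ ?_
      · exact (measurable_step.comp (measurable_id.sub_const _)).aestronglyMeasurable
      · exact Eventually.of_forall fun u => by simpa using norm_step_le (u - S.pos i)
  · rw [S.setIntegral_mass]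
    simp only [Matrix.cons_val, hstep, mul_zero, Finset.sum_const_zero, add_zero, ← hy]
    rw [Finset.mul_sum]
    congr 1
    refine Finset.sum_congr rfl fun i _ => ?_
    by_cases h : S.pos i ≤ x
    · simp [step, h]; ring
    · simp [step, h]

/-- The third order equation has a solution with arbitrary values of `f, f_ξ, f_{ξξ}` at `0`. -/
theorem exists_isSolution_zero (c : ℂ) (v : Fin 3 → ℂ) :
    ∃ F, S.IsSolution c F ∧ ∀ k, F k 0 = v k := by
  obtain ⟨y, hy⟩ := exists_triangular (fun i k : Fin S.n => i < k) wellFounded_lt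
    (fun k => v 0 + v 1 * S.pos k + v 2 * ((S.pos k : ℂ) ^ 2 / 2))
    (fun k i => c * S.wt i * (ramp (S.pos k - S.pos i) ^ 2 / 2))
  refine ⟨_, S.isSolution_ansatz c (v 0) (v 1) (v 2) y fun k => ?_, fun k => ?_⟩
  · rw [hy]
    congr 1
    refine Finset.sum_congr rfl fun i _ => ?_
    by_cases h : i < k
    · simp only [h, if_true]; ring
    · have : S.pos k ≤ S.pos i := S.strictMono_pos.monotone (not_lt.mp h)
      simp [h, ramp, this]
  · have h1 : ∀ i, ramp (0 - S.pos i) = 0 := fun i => by simp [ramp, (S.pos_pos i).le]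
    have h2 : ∀ i, step (0 - S.pos i) = 0 := fun i => by
      have := S.pos_pos i
      simp [step, this]
    fin_cases k <;> simp only [Matrix.cons_val, Fin.zero_eta, Fin.mk_one, Fin.reduceFinMk, h1, h2]
      <;> simp

/-- The third order equation has a solution with arbitrary values of `f, f_ξ, f_{ξξ}` at `1`. -/
theorem exists_isSolution_one (c : ℂ) (v : Fin 3 → ℂ) :
    ∃ F, S.IsSolution c F ∧ ∀ k, F k 1 = v k := by
  obtain ⟨y, hy⟩ := exists_triangular (fun i k : Fin S.n => k < i) wellFounded_gt
    (fun k => v 0 + v 1 * (S.pos k - 1) + v 2 * (((S.pos k : ℂ) - 1) ^ 2 / 2))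
    (fun k i => -(c * S.wt i * (((S.pos k : ℂ) - S.pos i) ^ 2 / 2)))
  have hr : ∀ i, ramp (1 - S.pos i) = 1 - S.pos i := fun i => by
    simp [ramp, S.pos_le_one i]
  have hs : ∀ i, step (1 - S.pos i) = 1 := fun i => by simp [step, S.pos_le_one i]
  refine ⟨_, S.isSolution_ansatz c
    (v 0 - v 1 + v 2 / 2 - ∑ i, c * S.wt i * y i * ((S.pos i : ℂ) ^ 2 / 2))
    (v 1 - v 2 + ∑ i, c * S.wt i * y i * S.pos i)
    (v 2 - ∑ i, c * S.wt i * y i) y fun k => ?_, fun k => ?_⟩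
  · have key : ∀ i, (if k < i then -(c * S.wt i * (((S.pos k : ℂ) - S.pos i) ^ 2 / 2)) * y i else 0)
        = -(c * S.wt i * y i * (((S.pos k : ℂ) - S.pos i) ^ 2 / 2))
          + c * S.wt i * y i * (ramp (S.pos k - S.pos i) ^ 2 / 2) := by
      intro i
      by_cases h : k < i
      · have : S.pos k ≤ S.pos i := (S.strictMono_pos h).le
        simp only [h, if_true, ramp, sub_nonpos, this, max_eq_right]
        push_cast; ring
      · have : S.pos i ≤ S.pos k := S.strictMono_pos.monotone (not_lt.mp h)
        simp only [h, if_false, ramp, sub_nonneg, this, max_eq_left]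
        push_cast; ring
    rw [hy, Finset.sum_congr rfl fun i _ => key i, Finset.sum_add_distrib, ← add_assoc]
    congr 1
    simp only [sub_mul, add_mul, Finset.sum_mul, Finset.sum_neg_distrib]
    have : ∀ i, c * S.wt i * y i * (((S.pos k : ℂ) - S.pos i) ^ 2 / 2)
        = c * S.wt i * y i * ((S.pos i : ℂ) ^ 2 / 2) - c * S.wt i * y i * S.pos i * S.pos k
          + c * S.wt i * y i * ((S.pos k : ℂ) ^ 2 / 2) := fun i => by ring
    simp only [this, Finset.sum_add_distrib, Finset.sum_sub_distrib]
    ring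
  · fin_cases k
    · simp only [Matrix.cons_val, Fin.zero_eta, hr]
      have : ∀ i, c * S.wt i * y i * ((1 - (S.pos i : ℂ)) ^ 2 / 2)
        = c * S.wt i * y i * ((S.pos i : ℂ) ^ 2 / 2) - c * S.wt i * y i * S.pos i
          + c * S.wt i * y i * (1 / 2) := fun i => by ring
      simp only [this, Finset.sum_add_distrib, Finset.sum_sub_distrib, ← Finset.sum_mul]
      push_cast; ring
    · simp only [Matrix.cons_val, Fin.mk_one, hr, mul_sub, mul_one, Finset.sum_sub_distrib]
      push_cast; ring
    · simp only [Matrix.cons_val, Fin.reduceFinMk, hs, mul_one]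
      ring

/-! ### The initial and boundary value problems -/

/-- The solution `(φ, φ_ξ, φ_{ξξ})(ξ; z)` of `-φ_{ξξξ} = z g φ` with `φ(0) = φ_ξ(0) = 0` and
`φ_{ξξ}(0) = 1`; its restriction to `[0, 1]` is uniquely determined.
`S.phi z k ξ` is the `k`-th derivative of `φ(·; z)` at `ξ`. -/
noncomputable def phi (z : ℂ) : Fin 3 → ℝ → ℂ :=
  (S.exists_isSolution_zero (-z) ![0, 0, 1]).choose

theorem phi_spec (z : ℂ) :
    S.IsSolution (-z) (S.phi z) ∧ ∀ k, S.phi z k 0 = ![0, 0, 1] k :=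
  (S.exists_isSolution_zero (-z) ![0, 0, 1]).choose_spec

/-- The values `(φ*(1), φ*_ξ(1), φ*_{ξξ}(1))` for the adjoint initial value problem of
type `a`. -/
def adjointValue : Fin 3 → Fin 3 → ℂ :=
  ![![0, 0, 1], ![0, 1, 0], ![1, 0, 0]]

/-- The solution `(φ*_a, φ*_{a,ξ}, φ*_{a,ξξ})(ξ; z)` of `φ*_{ξξξ} = z g φ*` with the
values `adjointValue a` at `1`; its restriction to `[0, 1]` is uniquely determined. -/
noncomputable def phiStar (a : Fin 3) (z : ℂ) : Fin 3 → ℝ → ℂ :=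
  (S.exists_isSolution_one z (adjointValue a)).choose

theorem phiStar_spec (a : Fin 3) (z : ℂ) :
    S.IsSolution z (S.phiStar a z) ∧ ∀ k, S.phiStar a z k 1 = adjointValue a k :=
  (S.exists_isSolution_one z (adjointValue a)).choose_spec

/-- The spectrum of the boundary value problem of type `a`:
`-φ_{ξξξ} = z g φ`, `φ(0) = φ_ξ(0) = 0`, and `φ(1) = 0` (type 0), `φ_ξ(1) = 0` (type 1),
`φ_{ξξ}(1) = 0` (type 2). -/
def spectrum (a : Fin 3) : Set ℂ :=
  {z | ∃ F, S.IsSolution (-z) F ∧ F 0 0 = 0 ∧ F 1 0 = 0 ∧ F a 1 = 0 ∧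
    ∃ x ∈ Icc (0 : ℝ) 1, F 0 x ≠ 0}

/-! ### Weyl functions and spectral measures -/

/-- The Weyl function `W` of type `a`. -/
noncomputable def weylW : Fin 3 → ℂ → ℂ :=
  ![fun z => S.phi z 1 1 / S.phi z 0 1,
    fun z => -(S.phi z 0 1 / S.phi z 1 1),
    fun z => -(S.phi z 1 1 / S.phi z 2 1)]

/-- The Weyl function `Z` of type `a`. -/
noncomputable def weylZ : Fin 3 → ℂ → ℂ :=
  ![fun z => S.phi z 2 1 / S.phi z 0 1,
    fun z => S.phi z 2 1 / S.phi z 1 1,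
    fun z => -(S.phi z 0 1 / S.phi z 2 1)]

/-- The residue of `M` at `z`, where `M` has at most a simple pole. -/
noncomputable def residue (M : ℂ → ℂ) (z : ℂ) : ℂ :=
  limUnder (𝓝[≠] z) fun w => (w - z) * M w

/-- The discrete measure `∑ Res_{x} M • δ_x`, summed over the points `x` of the spectrum of
type `a`. -/
noncomputable def spectralMeasure (a : Fin 3) (M : ℂ → ℂ) : Measure ℝ :=
  Measure.sum fun x : {x : ℝ // (x : ℂ) ∈ S.spectrum a} =>
    ENNReal.ofReal (residue M (x.1 : ℂ)).re • Measure.dirac x.1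

/-- The spectrum of type `a` is a finite set of positive real numbers, at each of which `M` has
a simple pole with a positive residue. -/
def PositiveSimplePoles (a : Fin 3) (M : ℂ → ℂ) : Prop :=
  (S.spectrum a).Finite ∧ ∀ z ∈ S.spectrum a, ∃ x A : ℝ, 0 < x ∧ 0 < A ∧ z = x ∧
    Tendsto (fun w => (w - z) * M w) (𝓝[≠] z) (𝓝 (A : ℂ))

/-- The bilinear form `(f, h)_g = ∫ f h g dξ`. -/
noncomputable def form (f h : ℝ → ℂ) : ℂ := ∫ x, f x * h x ∂S.mass

/-- The generalized Fourier transform of type `a`. -/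
noncomputable def fourier (a : Fin 3) (f : ℝ → ℂ) (z : ℂ) : ℂ :=
  (-1) ^ (a : ℕ) * ∫ x, S.phiStar a z 0 x * f x ∂S.mass

end DiscreteCubicString

/-- The Cauchy pairing `⟨p | q⟩ = ∬ p(x) q(y) / (x + y) dα(x) dβ(y)`. -/
noncomputable def cauchyPairing (α β : Measure ℝ) (p q : ℝ → ℂ) : ℂ :=
  ∫ x, ∫ y, p x * q y / ((x : ℂ) + y) ∂β ∂α

/-- The pairs of types of boundary value problems for which `(φ_{a,i}, φ_{b,j})_g`
factorizes. -/
inductive FactorizingPair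
  | type00
  | type01
  | type12
  | type22

namespace FactorizingPair

/-- The first type `a` of the pair. -/
def fst : FactorizingPair → Fin 3
  | type00 => 0
  | type01 => 0
  | type12 => 1
  | type22 => 2

/-- The second type `b` of the pair. -/
def snd : FactorizingPair → Fin 3
  | type00 => 0
  | type01 => 1
  | type12 => 2
  | type22 => 2

/-- The Weyl function, of the first type of the pair, whose residues are the weights of `α`. -/
noncomputable def fstWeyl (S : DiscreteCubicString) : FactorizingPair → ℂ → ℂ
  | type00 => S.weylW 0
  | type01 => S.weylZ 0
  | type12 => S.weylZ 1
  | type22 => S.weylW 2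

/-- The Weyl function, of the second type of the pair, whose residues are the weights of `β`. -/
noncomputable def sndWeyl (S : DiscreteCubicString) : FactorizingPair → ℂ → ℂ
  | type00 => S.weylW 0
  | type01 => S.weylW 1
  | type12 => S.weylZ 2
  | type22 => S.weylW 2

/-- The measure `α`. -/
noncomputable def alpha (P : FactorizingPair) (S : DiscreteCubicString) : Measure ℝ :=
  S.spectralMeasure P.fst (P.fstWeyl S)

/-- The measure `β`. -/
noncomputable def beta (P : FactorizingPair) (S : DiscreteCubicString) : Measure ℝ :=
  S.spectralMeasure P.snd (P.sndWeyl S)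

end FactorizingPair

/-! Both sides of the identity are finite sums. Write `D_j(z)` for the `j`-th derivative of `φ(·;
z)` at `1`, that is `endPoly j`. It is a real polynomial in `z`, and the spectrum of type `a` is its
zero set.

The Lagrange identity `IsSolution.lagrange` is used twice. Applied to `φ(·; z)` and `φ*_a(·; w)`, it
shows that on the spectrum of type `a` these two families are biorthogonal in `L²_g`, with norming
constants `-(-1)^a D_a'`. Once there are as many eigenvalues as masses, biorthogonality becomes
completeness, and every `f` expands in eigenfunctions with coefficients `-f̂_a / D_a'`
(`eq_sum_fourier`). Applied to `φ(·; x)` and `φ(·; y)`, it evaluates `(x + y) (φ_x, φ_y)_g` as a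
boundary term at `1` with three summands. For the four admissible pairs the boundary conditions
leave one product, a function of `x` times a function of `y` (`neg_concomitant_eq`). Expanding `f`
in type `a` and `h` in type `b` then gives the Cauchy kernel, and dividing these factors by `D_a'`
and `D_b'` yields the residues of the Weyl functions.

There remain the reality, positivity and simplicity of the spectra and the signs of the residues.
All but the absence of nonpositive eigenvalues follow from a single system of inequalities,
`IsOscillating`, preserved when passing from node to node. It is used over `ℂ` to exclude nonreal
zeros, and over the dual numbers to sign the Wronskians `D_i' D_j - D_i D_j'` for `i < j`. The count
of eigenvalues is the degree `n` of `D_a` (`natDegree_endPoly`). -/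

namespace DiscreteCubicString

open Polynomial

/-! ### The string as a sequence of nodes -/

/-- The endpoint `0`, followed by the positions of the masses and the endpoint `1`. -/
noncomputable def node (S : DiscreteCubicString) : ℕ → ℝ
  | 0 => 0
  | k + 1 => if h : k < S.n then S.pos ⟨k, h⟩ else 1

/-- The mass at `S.node (k + 1)`, with an additional zero mass at the endpoint `1`. -/
noncomputable def weight (S : DiscreteCubicString) (k : ℕ) : ℝ :=
  if h : k < S.n then S.wt ⟨k, h⟩ else 0

/-- The distance between consecutive nodes. -/
noncomputable def gap (S : DiscreteCubicString) (k : ℕ) : ℝ := S.node (k + 1) - S.node k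

variable (S : DiscreteCubicString)

theorem node_zero : S.node 0 = 0 := rfl

theorem node_succ (i : Fin S.n) : S.node (i + 1) = S.pos i := by simp [node]

theorem node_last : S.node (S.n + 1) = 1 := by simp [node]

theorem weight_coe (i : Fin S.n) : S.weight i = S.wt i := by simp [weight]

theorem weight_last : S.weight S.n = 0 := by simp [weight]

theorem weight_pos {k : ℕ} (hk : k < S.n) : 0 < S.weight k := by
  simp [weight, hk, S.wt_pos]

theorem weight_nonneg (k : ℕ) : 0 ≤ S.weight k := by
  unfold weight
  split_ifs with h
  exacts [(S.wt_pos _).le, le_rfl]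

theorem gap_pos {k : ℕ} (hk : k < S.n) : 0 < S.gap k := by
  cases k with
  | zero => simpa [gap, node, hk] using S.pos_pos _
  | succ k =>
    have h : k < S.n := by omega
    simpa [gap, node, hk, h] using S.strictMono_pos (Fin.mk_lt_mk.2 (Nat.lt_succ_self k))

theorem gap_nonneg (k : ℕ) : 0 ≤ S.gap k := by
  rcases lt_or_ge k S.n with hk | hk
  · exact (S.gap_pos hk).le
  · cases k with
    | zero => simp [gap, node, hk.not_gt]
    | succ k =>
      have h : ¬ k + 1 < S.n := by omega
      by_cases h' : k < S.n
      · simpa [gap, node, h, h'] using S.pos_le_one _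
      · simp [gap, node, h, h']

theorem gap_zero_pos : 0 < S.gap 0 := by
  by_cases h : 0 < S.n
  · exact S.gap_pos h
  · simp [gap, node, h]

theorem gap_last_pos (hS : S.Nondegenerate) : 0 < S.gap S.n := by
  rcases Nat.eq_zero_or_pos S.n with h | h
  · rw [h]; exact S.gap_zero_pos
  · obtain ⟨k, hk⟩ : ∃ k, S.n = k + 1 := ⟨S.n - 1, by omega⟩
    have h' : k < S.n := by omega
    have := hS ⟨k, h'⟩
    rw [gap, node_last, hk]
    simpa [node, h'] using this

theorem monotone_node : Monotone S.node :=
  monotone_nat_of_le_succ fun k => sub_nonneg.1 (S.gap_nonneg k)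

theorem node_mem {k : ℕ} (hk : k ≤ S.n + 1) : S.node k ∈ Icc (0 : ℝ) 1 :=
  ⟨S.monotone_node (Nat.zero_le k), S.node_last ▸ S.monotone_node hk⟩

/-! ### Integrals with respect to the mass distribution -/

theorem integral_mass (f : ℝ → ℂ) :
    ∫ t, f t ∂S.mass = ∑ i, (S.wt i : ℂ) * f (S.pos i) := by
  rw [mass, integral_finsetSum_measure]
  · refine Finset.sum_congr rfl fun i _ => ?_
    rw [integral_smul_measure, integral_dirac, ENNReal.toReal_ofReal (S.wt_pos i).le]
    simp
  · intro i _
    exact (integrable_dirac (by simp)).smul_measure ENNReal.ofReal_ne_top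

/-! ### Closed form of the solutions -/

variable {S} {c d : ℂ} {F G : Fin 3 → ℝ → ℂ}

/-- Integrating downwards from `F 2`, this and the next two lemmas show that a solution is
determined by its data at `0` and its values at the masses. -/
theorem IsSolution.two_eq (hF : S.IsSolution c F) {x : ℝ} (hx : x ∈ Icc (0 : ℝ) 1) :
    F 2 x = F 2 0 + ∑ i, c * S.wt i * F 0 (S.pos i) * step (x - S.pos i) := by
  rw [hF.eq_two x hx, S.setIntegral_mass, Finset.mul_sum]
  congr 1
  refine Finset.sum_congr rfl fun i _ => ?_
  by_cases h : S.pos i ≤ x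
  · simp [step, h, mul_assoc]
  · simp [step, h]

theorem IsSolution.one_eq (hF : S.IsSolution c F) {x : ℝ} (hx : x ∈ Icc (0 : ℝ) 1) :
    F 1 x = F 1 0 + F 2 0 * x + ∑ i, c * S.wt i * F 0 (S.pos i) * ramp (x - S.pos i) := by
  have hid : ∀ x : ℝ, HasDerivAt (fun y : ℝ => (y : ℂ)) 1 x :=
    fun x => Complex.ofRealCLM.hasDerivAt (x := x)
  have h0 : ∀ i, ramp (-S.pos i) = 0 := fun i => by simp [ramp, (S.pos_pos i).le]
  have hI : ∫ t in (0 : ℝ)..x, F 2 t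
      = ∫ t in (0 : ℝ)..x, (F 2 0 + ∑ i, c * S.wt i * F 0 (S.pos i) * step (t - S.pos i)) := by
    refine intervalIntegral.integral_congr fun t ht => ?_
    rw [uIcc_of_le hx.1] at ht
    exact hF.two_eq ⟨ht.1, ht.2.trans hx.2⟩
  rw [hF.eq_one x hx, hI, intervalIntegral.integral_eq_sub_of_hasDeriv_right
    (f := fun x : ℝ => F 2 0 * x + ∑ i, c * S.wt i * F 0 (S.pos i) * ramp (x - S.pos i))]
  · simp [h0]; ring
  · have := continuous_ramp
    fun_prop
  · intro t _
    have h1 := ((hid t).const_mul (F 2 0)).hasDerivWithinAt (s := Ioi t)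
    have h2 : HasDerivWithinAt
        (fun x => ∑ i, c * S.wt i * F 0 (S.pos i) * ramp (x - S.pos i))
        (∑ i, c * S.wt i * F 0 (S.pos i) * step (t - S.pos i)) (Ioi t) t := by
      refine HasDerivWithinAt.fun_sum fun i _ => HasDerivWithinAt.const_mul _ ?_
      have h3 := (hasDerivWithinAt_ramp (t - S.pos i)).scomp t
        (((hasDerivAt_id t).sub_const (S.pos i)).hasDerivWithinAt (s := Ioi t))
        (fun u hu => by simpa using hu)
      simpa [Function.comp_def] using h3
    exact (h1.add h2).congr_deriv (by ring)
  · refine (intervalIntegrable_const).add ?_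
    have hsum : (fun x => ∑ i, c * S.wt i * F 0 (S.pos i) * step (x - S.pos i))
        = ∑ i, fun x => c * S.wt i * F 0 (S.pos i) * step (x - S.pos i) := by
      ext u; simp
    rw [hsum]
    refine IntervalIntegrable.sum _ fun i _ => IntervalIntegrable.const_mul ?_ _
    refine (intervalIntegrable_const (c := (1 : ℝ))).mono_fun ?_ ?_
    · exact (measurable_step.comp (measurable_id.sub_const _)).aestronglyMeasurable
    · exact Eventually.of_forall fun u => by simpa using norm_step_le (u - S.pos i)

theorem IsSolution.zero_eq (hF : S.IsSolution c F) {x : ℝ} (hx : x ∈ Icc (0 : ℝ) 1) :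
    F 0 x = F 0 0 + F 1 0 * x + F 2 0 * ((x : ℂ) ^ 2 / 2)
      + ∑ i, c * S.wt i * F 0 (S.pos i) * (ramp (x - S.pos i) ^ 2 / 2) := by
  have hid : ∀ x : ℝ, HasDerivAt (fun y : ℝ => (y : ℂ)) 1 x :=
    fun x => Complex.ofRealCLM.hasDerivAt (x := x)
  have h0 : ∀ i, ramp (-S.pos i) = 0 := fun i => by simp [ramp, (S.pos_pos i).le]
  have hI : ∫ t in (0 : ℝ)..x, F 1 t = ∫ t in (0 : ℝ)..x, (F 1 0 + F 2 0 * t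
      + ∑ i, c * S.wt i * F 0 (S.pos i) * ramp (t - S.pos i)) := by
    refine intervalIntegral.integral_congr fun t ht => ?_
    rw [uIcc_of_le hx.1] at ht
    exact hF.one_eq ⟨ht.1, ht.2.trans hx.2⟩
  rw [hF.eq_zero x hx, hI, intervalIntegral.integral_eq_sub_of_hasDerivAt
    (f := fun x : ℝ => F 1 0 * x + F 2 0 * ((x : ℂ) ^ 2 / 2)
      + ∑ i, c * S.wt i * F 0 (S.pos i) * (ramp (x - S.pos i) ^ 2 / 2))]
  · simp [h0]; ring
  · intro t _
    have h1 := ((hid t).const_mul (F 1 0)).add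
      ((((hid t).pow 2).div_const 2).const_mul (F 2 0))
    have h2 : HasDerivAt
        (fun x => ∑ i, c * S.wt i * F 0 (S.pos i) * (ramp (x - S.pos i) ^ 2 / 2))
        (∑ i, c * S.wt i * F 0 (S.pos i) * ramp (t - S.pos i)) t :=
      HasDerivAt.fun_sum fun i _ =>
        ((hasDerivAt_ramp_sq (t - S.pos i)).comp_sub_const t (S.pos i)).const_mul _
    exact (h1.add h2).congr_deriv (by push_cast; ring)
  · refine Continuous.intervalIntegrable ?_ _ _
    have := continuous_ramp
    fun_prop

/-! ### Transfer between consecutive nodes -/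

theorem pos_le_node_or_node_succ_le_pos (k : ℕ) (i : Fin S.n) :
    S.pos i ≤ S.node k ∨ S.node (k + 1) ≤ S.pos i := by
  rw [← S.node_succ]
  rcases lt_or_ge (i : ℕ) k with h | h
  · exact Or.inl (S.monotone_node h)
  · exact Or.inr (S.monotone_node (by omega))

/-- The kink `x` does not lie strictly between `a` and `b`, so the ramp is affine from `a` to `b`
and its Taylor formula is exact. -/
theorem ramp_taylor {a b x : ℝ} (hab : a ≤ b) (h : x ≤ a ∨ b ≤ x) :
    ramp (b - x) = ramp (a - x) + ((b - a : ℝ) : ℂ) * step (a - x) := by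
  rcases eq_or_lt_of_le hab with rfl | hab
  · simp
  rcases h with h | h
  · have h' := h.trans hab.le
    simp [ramp, step, h, h']
  · have h' : ¬ x ≤ a := by linarith
    have h'' : a ≤ x := by linarith
    simp [ramp, step, h, h', h'']

theorem ramp_sq_taylor {a b x : ℝ} (hab : a ≤ b) (h : x ≤ a ∨ b ≤ x) :
    ramp (b - x) ^ 2 / 2 = ramp (a - x) ^ 2 / 2 + ((b - a : ℝ) : ℂ) * ramp (a - x)
      + ((b - a : ℝ) : ℂ) ^ 2 / 2 * step (a - x) := by
  have hs : step (a - x) ^ 2 = step (a - x) := by unfold step; split_ifs <;> simp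
  rw [ramp_taylor hab h]
  by_cases h' : 0 ≤ a - x
  · simp only [step, h', if_true]; ring
  · simp [step, h', ramp, (not_le.1 h').le]

theorem IsSolution.zero_node_succ (hF : S.IsSolution c F) {k : ℕ} (hk : k ≤ S.n) :
    F 0 (S.node (k + 1)) = F 0 (S.node k) + S.gap k * F 1 (S.node k)
      + (S.gap k : ℂ) ^ 2 / 2 * F 2 (S.node k) := by
  rw [hF.zero_eq (S.node_mem (by omega)), hF.zero_eq (S.node_mem (k := k) (by omega)),
    hF.one_eq (S.node_mem (by omega)), hF.two_eq (S.node_mem (by omega)),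
    Finset.sum_congr rfl fun i _ => by
      rw [ramp_sq_taylor (S.monotone_node k.le_succ) (S.pos_le_node_or_node_succ_le_pos k i)]]
  simp only [mul_add, Finset.sum_add_distrib, Finset.mul_sum]
  have h1 : ∀ i, c * S.wt i * F 0 (S.pos i) * (((S.node (k + 1) - S.node k : ℝ) : ℂ)
      * ramp (S.node k - S.pos i))
      = S.gap k * (c * S.wt i * F 0 (S.pos i) * ramp (S.node k - S.pos i)) := fun i => by
    rw [gap]; ring
  have h2 : ∀ i, c * S.wt i * F 0 (S.pos i) * (((S.node (k + 1) - S.node k : ℝ) : ℂ) ^ 2 / 2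
      * step (S.node k - S.pos i))
      = (S.gap k : ℂ) ^ 2 / 2 * (c * S.wt i * F 0 (S.pos i) * step (S.node k - S.pos i)) :=
    fun i => by rw [gap]; ring
  simp only [Nat.succ_eq_add_one, h1, h2]
  rw [show S.node (k + 1) = S.node k + S.gap k by rw [gap]; ring]
  push_cast
  ring

theorem IsSolution.one_node_succ (hF : S.IsSolution c F) {k : ℕ} (hk : k ≤ S.n) :
    F 1 (S.node (k + 1)) = F 1 (S.node k) + S.gap k * F 2 (S.node k) := by
  rw [hF.one_eq (S.node_mem (by omega)), hF.one_eq (S.node_mem (k := k) (by omega)),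
    hF.two_eq (S.node_mem (by omega)),
    Finset.sum_congr rfl fun i _ => by
      rw [ramp_taylor (S.monotone_node k.le_succ) (S.pos_le_node_or_node_succ_le_pos k i)]]
  simp only [mul_add, Finset.sum_add_distrib, Finset.mul_sum]
  have h1 : ∀ i, c * S.wt i * F 0 (S.pos i) * (((S.node (k + 1) - S.node k : ℝ) : ℂ)
      * step (S.node k - S.pos i))
      = S.gap k * (c * S.wt i * F 0 (S.pos i) * step (S.node k - S.pos i)) := fun i => by
    rw [gap]; ring
  simp only [Nat.succ_eq_add_one, h1]
  rw [show S.node (k + 1) = S.node k + S.gap k by rw [gap]; ring]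
  push_cast
  ring

theorem step_node_sub_pos (k : ℕ) (i : Fin S.n) :
    step (S.node k - S.pos i) = if (i : ℕ) < k then 1 else 0 := by
  rcases lt_or_ge (i : ℕ) k with h | h
  · have := S.monotone_node (Nat.succ_le_of_lt h)
    rw [Nat.succ_eq_add_one, S.node_succ] at this
    simp [step, h, this]
  · have h1 := S.gap_pos (k := i) i.2
    rw [gap, S.node_succ] at h1
    have h2 := S.monotone_node h
    have : ¬ S.pos i ≤ S.node k := by linarith
    simp [step, h.not_gt, this]

theorem IsSolution.two_node_succ (hF : S.IsSolution c F) {k : ℕ} (hk : k ≤ S.n) :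
    F 2 (S.node (k + 1)) = F 2 (S.node k) + c * S.weight k * F 0 (S.node (k + 1)) := by
  rw [hF.two_eq (S.node_mem (by omega)), hF.two_eq (S.node_mem (k := k) (by omega))]
  rcases hk.lt_or_eq with h | rfl
  · simp only [step_node_sub_pos k, step_node_sub_pos (k + 1)]
    have h3 : ∀ i : Fin S.n, (if (i : ℕ) < k + 1 then (1 : ℂ) else 0)
        = (if (i : ℕ) < k then 1 else 0) + if i = ⟨k, h⟩ then 1 else 0 := fun i => by
      simp only [Fin.ext_iff]
      split_ifs <;> first | omega | simp
    simp only [h3, mul_add, Finset.sum_add_distrib, mul_ite, mul_one, mul_zero,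
      Finset.sum_ite_eq', Finset.mem_univ, if_true]
    rw [← S.weight_coe ⟨k, h⟩, ← S.node_succ ⟨k, h⟩]
    ring
  -- No mass is left on the last step: a mass at `1` already sits at node `n`, which then coincides
  -- with node `n + 1`.
  · simp only [step_node_sub_pos S.n, S.node_last, weight_last]
    simp [step, S.pos_le_one]

/-! ### The Lagrange identity -/

/-- The bilinear concomitant of two solutions. -/
def concomitant (F G : Fin 3 → ℝ → ℂ) (x : ℝ) : ℂ :=
  F 2 x * G 0 x - F 1 x * G 1 x + F 0 x * G 2 x

/-- A telescoping sum over the nodes. Between masses both functions are quadratic and the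
concomitant is constant; the jumps of the second derivatives at a mass add `(c + d) gᵢ F G`. -/
theorem IsSolution.lagrange (hF : S.IsSolution c F) (hG : S.IsSolution d G) :
    concomitant F G 1 - concomitant F G 0
      = (c + d) * ∑ i, S.wt i * (F 0 (S.pos i) * G 0 (S.pos i)) := by
  have key : ∀ k ≤ S.n + 1, concomitant F G (S.node k) = concomitant F G 0 + (c + d) *
      ∑ i ∈ Finset.range k, S.weight i * (F 0 (S.node (i + 1)) * G 0 (S.node (i + 1))) := by
    intro k hk
    induction k with
    | zero => simp [node_zero]
    | succ k ih =>
      have hk' : k ≤ S.n := by omega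
      have ih := ih (by omega)
      rw [Finset.sum_range_succ, mul_add, ← add_assoc, ← ih]
      simp only [concomitant, hF.two_node_succ hk', hG.two_node_succ hk', hF.one_node_succ hk',
        hG.one_node_succ hk', hF.zero_node_succ hk', hG.zero_node_succ hk']
      ring
  have := key _ le_rfl
  rw [node_last, Finset.sum_range_succ, weight_last, Finset.sum_range] at this
  simp only [node_succ, weight_coe] at this
  rw [this]
  simp

/-! ### The solution `φ` as a polynomial in the spectral parameter -/

/-- The polynomials `φ, φ_ξ, φ_{ξξ}` in `z` at the `k`-th node. -/
noncomputable def poly (S : DiscreteCubicString) : ℕ → Fin 3 → ℝ[X]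
  | 0 => ![0, 0, 1]
  | k + 1 =>
    ![S.poly k 0 + C (S.gap k) * S.poly k 1 + C (S.gap k ^ 2 / 2) * S.poly k 2,
      S.poly k 1 + C (S.gap k) * S.poly k 2,
      S.poly k 2 - C (S.weight k) * X * (S.poly k 0 + C (S.gap k) * S.poly k 1
        + C (S.gap k ^ 2 / 2) * S.poly k 2)]

/-- The polynomials `φ, φ_ξ, φ_{ξξ}` in `z` at the endpoint `1`. -/
noncomputable def endPoly (S : DiscreteCubicString) : Fin 3 → ℝ[X] := S.poly (S.n + 1)

section

variable (S) (k : ℕ)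

theorem poly_succ_zero : S.poly (k + 1) 0
    = S.poly k 0 + C (S.gap k) * S.poly k 1 + C (S.gap k ^ 2 / 2) * S.poly k 2 := rfl

theorem poly_succ_one : S.poly (k + 1) 1 = S.poly k 1 + C (S.gap k) * S.poly k 2 := rfl

theorem poly_succ_two :
    S.poly (k + 1) 2 = S.poly k 2 - C (S.weight k) * X * S.poly (k + 1) 0 := rfl

end

variable {z : ℂ}

/-- The two conditions at `0` leave only the factor `F 2 0` free, so every such solution is a
multiple of `φ`. -/
theorem IsSolution.node_eq (hF : S.IsSolution (-z) F) (h0 : F 0 0 = 0) (h1 : F 1 0 = 0)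
    {k : ℕ} (hk : k ≤ S.n + 1) (j : Fin 3) :
    F j (S.node k) = F 2 0 * aeval z (S.poly k j) := by
  induction k generalizing j with
  | zero => fin_cases j <;> simp [node_zero, poly, h0, h1]
  | succ k ih =>
    have hk' : k ≤ S.n := by omega
    have ih := ih (by omega)
    have e0 : F 0 (S.node (k + 1)) = F 2 0 * aeval z (S.poly (k + 1) 0) := by
      rw [hF.zero_node_succ hk', ih, ih, ih, poly_succ_zero]
      simp
      ring
    fin_cases j
    · exact e0
    · simp only [Fin.mk_one]
      rw [hF.one_node_succ hk', ih, ih, poly_succ_one]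
      simp
      ring
    · simp only [Fin.reduceFinMk]
      rw [hF.two_node_succ hk', ih, e0, poly_succ_two]
      simp
      ring

theorem phi_node {k : ℕ} (hk : k ≤ S.n + 1) (j : Fin 3) :
    S.phi z j (S.node k) = aeval z (S.poly k j) := by
  have h := (S.phi_spec z).2
  simpa [h] using (S.phi_spec z).1.node_eq (by simp [h]) (by simp [h]) hk j

theorem phi_one (j : Fin 3) : S.phi z j 1 = aeval z (S.endPoly j) := by
  have := phi_node (S := S) (z := z) le_rfl j
  rwa [node_last] at this

theorem phi_pos (i : Fin S.n) : S.phi z 0 (S.pos i) = aeval z (S.poly (i + 1) 0) := by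
  rw [← phi_node (by omega), node_succ]

theorem mem_spectrum_iff {a : Fin 3} : z ∈ S.spectrum a ↔ aeval z (S.endPoly a) = 0 := by
  constructor
  · rintro ⟨F, hF, h0, h1, ha, x, hx, hne⟩
    have hn := hF.node_eq h0 h1 (k := S.n + 1) le_rfl a
    rw [node_last, ha, eq_comm, mul_eq_zero] at hn
    refine hn.resolve_left fun h2 => hne ?_
    have hp : ∀ i, F 0 (S.pos i) = 0 := fun i => by
      rw [← S.node_succ, hF.node_eq h0 h1 (by omega), h2, zero_mul]
    rw [hF.zero_eq hx]
    simp [h0, h1, h2, hp]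
  · intro h
    have hs := (S.phi_spec z).2
    -- The witness for nontriviality is the first node, where `φ` equals `gap 0 ^ 2 / 2` for every
    -- `z`.
    refine ⟨S.phi z, (S.phi_spec z).1, by simp [hs], by simp [hs], by rw [phi_one, h],
      S.node 1, S.node_mem (by omega), ?_⟩
    rw [phi_node (by omega)]
    have := S.gap_zero_pos.ne'
    simp [poly, this]

/-! ### Total positivity -/

/-- The algebra behind the oscillation properties.  In `ℝ[ω]` with `ω ^ 2 = -s`, let
`z = x + y ω` and `D i = a i + b i ω`.  For `i < j` the `ω`-components of `D i * conj (D j)` and of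
`z * D i * conj (D j)` are nonnegative, the latter positive. -/
structure IsOscillating (s x y : ℝ) (a b : Fin 3 → ℝ) : Prop where
  im01 : 0 ≤ b 0 * a 1 - a 0 * b 1
  im02 : 0 ≤ b 0 * a 2 - a 0 * b 2
  im12 : 0 ≤ b 1 * a 2 - a 1 * b 2
  zim01 : 0 < y * (a 0 * a 1 + s * (b 0 * b 1)) + x * (b 0 * a 1 - a 0 * b 1)
  zim02 : 0 < y * (a 0 * a 2 + s * (b 0 * b 2)) + x * (b 0 * a 2 - a 0 * b 2)
  zim12 : 0 < y * (a 1 * a 2 + s * (b 1 * b 2)) + x * (b 1 * a 2 - a 1 * b 2)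

/-- A massless interval of length `l` acts by `D ↦ (D 0 + l D 1 + l²/2 D 2, D 1 + l D 2, D 2)`. Each
new expression is a combination, with nonnegative coefficients, of the old ones and of terms `y
|u|²`. -/
theorem IsOscillating.translate {s x y l : ℝ} {a b : Fin 3 → ℝ} (h : IsOscillating s x y a b)
    (hs : 0 ≤ s) (hy : 0 ≤ y) (hl : 0 ≤ l) :
    IsOscillating s x y ![a 0 + l * a 1 + l ^ 2 / 2 * a 2, a 1 + l * a 2, a 2]
      ![b 0 + l * b 1 + l ^ 2 / 2 * b 2, b 1 + l * b 2, b 2] := by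
  obtain ⟨h1, h2, h3, h4, h5, h6⟩ := h
  have hn : ∀ u v : ℝ, 0 ≤ y * (u ^ 2 + s * v ^ 2) := fun u v => by positivity
  constructor <;> simp only [Matrix.cons_val]
  · have := add_nonneg (add_nonneg h1 (mul_nonneg hl h2)) (mul_nonneg (by positivity) h3 :
      0 ≤ l ^ 2 / 2 * (b 1 * a 2 - a 1 * b 2))
    refine this.trans_eq (by ring)
  · refine (add_nonneg h2 (mul_nonneg hl h3)).trans_eq (by ring)
  · refine h3.trans_eq (by ring)
  -- The term `z * D 2 * conj (D 1)` has no definite sign by itself. Half of the term with `D 1` and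
  -- `D 2` exchanged turns it into a cross term, absorbed by completing the square in `y |D 1 +
  -- (l/2) D 2|²`.
  · have p1 := mul_nonneg hl h5.le
    have p2 := mul_nonneg (by positivity : 0 ≤ l ^ 2 / 2) h6.le
    have p3 := mul_nonneg hl (hn (a 1 + l / 2 * a 2) (b 1 + l / 2 * b 2))
    have p4 := mul_nonneg (by positivity : 0 ≤ l ^ 3 / 4) (hn (a 2) (b 2))
    refine (add_pos_of_pos_of_nonneg h4
      (add_nonneg (add_nonneg (add_nonneg p1 p2) p3) p4)).trans_eq ?_
    ring
  · have p1 := mul_nonneg hl h6.le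
    have p2 := mul_nonneg (by positivity : 0 ≤ l ^ 2 / 2) (hn (a 2) (b 2))
    refine (add_pos_of_pos_of_nonneg h5 (add_nonneg p1 p2)).trans_eq (by ring)
  · refine (add_pos_of_pos_of_nonneg h6 (mul_nonneg hl (hn (a 2) (b 2)))).trans_eq (by ring)

/-- A mass `g` acts by `D 2 ↦ D 2 - g z D 0`. The corrections are `g y |D 0|²`, the `ω`-component of
`g z D 0 conj (D 1)`, and `g |z|²` times that of `D 0 conj (D 1)`; all are nonnegative. -/
theorem IsOscillating.jump {s x y g : ℝ} {a b : Fin 3 → ℝ} (h : IsOscillating s x y a b)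
    (hs : 0 ≤ s) (hy : 0 ≤ y) (hg : 0 ≤ g) :
    IsOscillating s x y ![a 0, a 1, a 2 - g * (x * a 0 - s * y * b 0)]
      ![b 0, b 1, b 2 - g * (x * b 0 + y * a 0)] := by
  obtain ⟨h1, h2, h3, h4, h5, h6⟩ := h
  have hn : 0 ≤ g * (y * (a 0 ^ 2 + s * b 0 ^ 2)) := by positivity
  constructor <;> simp only [Matrix.cons_val]
  · exact h1
  · refine (add_nonneg h2 hn).trans_eq (by ring)
  · refine (add_nonneg h3 (mul_nonneg hg h4.le)).trans_eq (by ring)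
  · exact h4
  · refine h5.trans_eq (by ring)
  · refine (add_pos_of_pos_of_nonneg h6 (mul_nonneg (by positivity :
      0 ≤ g * (x ^ 2 + s * y ^ 2)) h1)).trans_eq (by ring)

/-- A sequence of triples with the recursion of the transfer between the nodes. -/
structure IsTransfer (S : DiscreteCubicString) (s x y : ℝ) (a b : ℕ → Fin 3 → ℝ) : Prop where
  a_zero : a 0 = ![0, 0, 1]
  b_zero : b 0 = 0
  a_succ_zero : ∀ k, a (k + 1) 0 = a k 0 + S.gap k * a k 1 + S.gap k ^ 2 / 2 * a k 2
  b_succ_zero : ∀ k, b (k + 1) 0 = b k 0 + S.gap k * b k 1 + S.gap k ^ 2 / 2 * b k 2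
  a_succ_one : ∀ k, a (k + 1) 1 = a k 1 + S.gap k * a k 2
  b_succ_one : ∀ k, b (k + 1) 1 = b k 1 + S.gap k * b k 2
  a_succ_two : ∀ k, a (k + 1) 2
    = a k 2 - S.weight k * (x * a (k + 1) 0 - s * y * b (k + 1) 0)
  b_succ_two : ∀ k, b (k + 1) 2
    = b k 2 - S.weight k * (x * b (k + 1) 0 + y * a (k + 1) 0)

namespace IsTransfer

variable {s x y : ℝ} {a b : ℕ → Fin 3 → ℝ}

/-- The induction starts after the first gap: at node `0` the triple is `(0, 0, 1)` and the strict
inequalities fail. -/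
theorem isOscillating_succ (h : IsTransfer S s x y a b) (hs : 0 ≤ s) (hy : 0 < y)
    (k : ℕ) :
    IsOscillating s x y (a (k + 1)) (b (k + 1)) := by
  have hjump : ∀ k, IsOscillating s x y
      ![a k 0 + S.gap k * a k 1 + S.gap k ^ 2 / 2 * a k 2, a k 1 + S.gap k * a k 2, a k 2]
      ![b k 0 + S.gap k * b k 1 + S.gap k ^ 2 / 2 * b k 2, b k 1 + S.gap k * b k 2, b k 2] →
      IsOscillating s x y (a (k + 1)) (b (k + 1)) := by
    intro k hk
    convert hk.jump hs hy.le (S.weight_nonneg k) using 1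
    · ext j
      fin_cases j <;> simp [h.a_succ_zero, h.a_succ_one, h.a_succ_two, h.b_succ_zero]
    · ext j
      fin_cases j <;> simp [h.a_succ_zero, h.b_succ_one, h.b_succ_two, h.b_succ_zero]
  induction k with
  | zero =>
    have := S.gap_zero_pos
    refine hjump 0 ?_
    simp only [h.a_zero, h.b_zero]
    constructor <;> simp <;> positivity
  | succ k ih => exact hjump _ (ih.translate hs hy.le (S.gap_nonneg _))

/-- These components vanish until the first mass makes them positive; later gaps and masses only
increase them. Hence the need for at least one mass. -/
theorem im12_pos (h : IsTransfer S s x y a b) (hs : 0 ≤ s) (hy : 0 < y)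
    (hn : 0 < S.n) (k : ℕ) :
    0 < b (k + 1) 0 * a (k + 1) 2 - a (k + 1) 0 * b (k + 1) 2 ∧
    0 < b (k + 1) 1 * a (k + 1) 2 - a (k + 1) 1 * b (k + 1) 2 := by
  induction k with
  | zero =>
    have := S.gap_zero_pos
    have := S.weight_pos hn
    simp only [zero_add, h.a_succ_two 0, h.b_succ_two 0]
    simp only [h.a_succ_zero 0, h.a_succ_one 0, h.b_succ_zero 0, h.b_succ_one 0, h.a_zero, h.b_zero]
    constructor <;> simp <;> ring_nf <;> positivity
  | succ k ih =>
    have hg := S.gap_nonneg (k + 1)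
    have hw := S.weight_nonneg (k + 1)
    have ho := h.isOscillating_succ hs hy (k + 1)
    have hn : 0 ≤ S.weight (k + 1) * (y * (a (k + 1 + 1) 0 ^ 2 + s * b (k + 1 + 1) 0 ^ 2)) := by
      positivity
    have h1 := mul_nonneg hw ho.zim01.le
    have h2 := mul_nonneg hg ih.2.le
    rw [h.a_succ_two (k + 1), h.b_succ_two (k + 1)]
    constructor
    · refine (add_pos_of_pos_of_nonneg (add_pos_of_pos_of_nonneg ih.1 h2) hn).trans_eq ?_
      rw [h.a_succ_zero (k + 1), h.b_succ_zero (k + 1)]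
      ring
    · refine (add_pos_of_pos_of_nonneg ih.2 h1).trans_eq ?_
      rw [h.a_succ_one (k + 1), h.b_succ_one (k + 1)]
      ring

/-- Strictness is inherited from `im12_pos` across the last gap, which has positive length exactly
in the nondegenerate case. -/
theorem im01_pos (h : IsTransfer S s x y a b) (hs : 0 ≤ s) (hy : 0 < y)
    (hn : 0 < S.n) (hS : S.Nondegenerate) :
    0 < b (S.n + 1) 0 * a (S.n + 1) 1 - a (S.n + 1) 0 * b (S.n + 1) 1 := by
  obtain ⟨k, hk⟩ : ∃ k, S.n = k + 1 := ⟨S.n - 1, by omega⟩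
  have hg := S.gap_last_pos hS
  rw [hk] at hg ⊢
  have h1 := (h.isOscillating_succ hs hy k).im01
  have h2 := mul_pos hg (h.im12_pos hs hy hn k).1
  have h3 := mul_pos (by positivity : 0 < S.gap (k + 1) ^ 2 / 2) (h.im12_pos hs hy hn k).2
  refine (add_pos_of_nonneg_of_pos h1 (add_pos h2 h3)).trans_eq ?_
  rw [h.a_succ_zero (k + 1), h.a_succ_one (k + 1), h.b_succ_zero (k + 1), h.b_succ_one (k + 1)]
  ring

end IsTransfer

/-- Evaluation at `x + ω` with `ω² = 0`: the `ω`-component is the derivative, so the `ω`-components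
of `D i * conj (D j)` are Wronskians. -/
theorem isTransfer_derivative (x : ℝ) : IsTransfer S 0 x 1 (fun k j => (S.poly k j).eval x)
    (fun k j => (derivative (S.poly k j)).eval x) := by
  constructor <;> try intro k
  · ext j; fin_cases j <;> simp [poly]
  · ext j; fin_cases j <;> simp [poly]
  · simp [poly_succ_zero]
  · simp [poly_succ_zero]
  · simp [poly_succ_one]
  · simp [poly_succ_one]
  · simp [poly_succ_two]; ring
  · simp [poly_succ_two]; ring

theorem isTransfer_complex (z : ℂ) : IsTransfer S 1 z.re z.im
    (fun k j => (aeval z (S.poly k j)).re) (fun k j => (aeval z (S.poly k j)).im) := by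
  constructor <;> try intro k
  · ext j; fin_cases j <;> simp [poly]
  · ext j; fin_cases j <;> simp [poly]
  · simp [poly_succ_zero]; norm_cast; simp
  · simp [poly_succ_zero]; norm_cast; simp
  · simp [poly_succ_one]
  · simp [poly_succ_one]
  · simp [poly_succ_two]; ring
  · simp [poly_succ_two]; ring

/-- For `x ≤ 0` the transfer has only nonnegative coefficients, which rules out eigenvalues `≤ 0`.
-/
theorem eval_poly_succ_pos {x : ℝ} (hx : x ≤ 0) (k : ℕ) (j : Fin 3) :
    0 < (S.poly (k + 1) j).eval x := by
  have hstep : ∀ k, 0 ≤ S.gap k → 0 < (S.poly (k + 1) 0).eval x → 0 < (S.poly (k + 1) 1).eval x →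
      0 < (S.poly k 2).eval x → ∀ j, 0 < (S.poly (k + 1) j).eval x := by
    intro k hg h0 h1 h2 j
    fin_cases j
    · exact h0
    · exact h1
    · have := mul_nonneg (mul_nonneg (S.weight_nonneg k) (neg_nonneg.2 hx)) h0.le
      simp only [Fin.reduceFinMk, poly_succ_two, eval_sub, eval_mul, eval_C, eval_X]
      linarith
  induction k generalizing j with
  | zero =>
    have := S.gap_zero_pos
    refine hstep 0 this.le ?_ ?_ ?_ j <;> simp [poly] <;> positivity
  | succ k ih =>
    have hg := S.gap_nonneg (k + 1)
    have h0 := ih 0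
    have h1 := ih 1
    have h2 := ih 2
    refine hstep _ hg ?_ ?_ h2 j
    · simp only [poly_succ_zero S (k + 1), eval_add, eval_mul, eval_C]
      positivity
    · simp only [poly_succ_one S (k + 1), eval_add, eval_mul, eval_C]
      positivity

/-- Each mass raises the degree of the second derivative by one, and the leading coefficient reaches
the lower derivatives only over the next gap. A missing last gap therefore costs types `0` and `1` a
degree, so only type `2` survives degeneracy. -/
theorem coeff_poly {k : ℕ} (hk : k ≤ S.n) :
    (∀ m, k ≤ m → (S.poly k 0).coeff m = 0) ∧ (∀ m, k ≤ m → (S.poly k 1).coeff m = 0) ∧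
    (∀ m, k < m → (S.poly k 2).coeff m = 0) ∧ (S.poly k 2).coeff k ≠ 0 := by
  induction k with
  | zero =>
    refine ⟨fun m _ => by simp [poly], fun m _ => by simp [poly], fun m hm => ?_, by simp [poly]⟩
    simp [poly, coeff_one, hm.ne']
  | succ k ih =>
    obtain ⟨h0, h1, h2, h3⟩ := ih (by omega)
    have h0' : ∀ m, k + 1 ≤ m → (S.poly (k + 1) 0).coeff m = 0 := fun m hm => by
      simp [poly_succ_zero, coeff_C_mul, h0 m (by omega), h1 m (by omega), h2 m (by omega)]
    refine ⟨h0', fun m hm => ?_, fun m hm => ?_, ?_⟩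
    · simp [poly_succ_one, coeff_C_mul, h1 m (by omega), h2 m (by omega)]
    · obtain ⟨m, rfl⟩ : ∃ l, m = l + 1 := ⟨m - 1, by omega⟩
      simp [poly_succ_two, mul_assoc, coeff_C_mul, h2 (m + 1) (by omega), h0' m (by omega)]
    · have hg := (S.gap_pos hk).ne'
      have hw := (S.weight_pos hk).ne'
      rw [poly_succ_two, mul_assoc, coeff_sub, coeff_C_mul, coeff_X_mul, h2 _ (by omega),
        poly_succ_zero]
      simp only [coeff_add, coeff_C_mul, h0 k le_rfl, h1 k le_rfl]
      simp [hg, hw, h3]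

theorem natDegree_endPoly {a : Fin 3} (ha : S.Nondegenerate ∨ a = 2) :
    (S.endPoly a).natDegree = S.n := by
  obtain ⟨h0, h1, h2, h3⟩ := S.coeff_poly le_rfl
  have e2 : S.endPoly 2 = S.poly S.n 2 := by
    simp [endPoly, poly_succ_two, weight_last]
  refine natDegree_eq_of_le_of_coeff_ne_zero (natDegree_le_iff_coeff_eq_zero.2 fun m hm => ?_) ?_
  · fin_cases a
    · simp [endPoly, poly_succ_zero, coeff_C_mul, h0 m hm.le, h1 m hm.le, h2 m hm]
    · simp [endPoly, poly_succ_one, coeff_C_mul, h1 m hm.le, h2 m hm]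
    · simpa [e2] using h2 m hm
  · rcases ha with hS | rfl
    · have hg := (S.gap_last_pos hS).ne'
      fin_cases a
      · simp [endPoly, poly_succ_zero, coeff_C_mul, h0 _ le_rfl, h1 _ le_rfl, h3, hg]
      · simp [endPoly, poly_succ_one, coeff_C_mul, h1 _ le_rfl, h3, hg]
      · simpa [e2] using h3
    · simpa [e2] using h3

/-! ### The spectra -/

theorem aeval_ofReal (x : ℝ) (p : ℝ[X]) : aeval (x : ℂ) p = ((p.eval x : ℝ) : ℂ) :=
  aeval_algebraMap_apply_eq_algebraMap_eval x p

theorem ofReal_mem_spectrum_iff {a : Fin 3} {x : ℝ} :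
    (x : ℂ) ∈ S.spectrum a ↔ (S.endPoly a).eval x = 0 := by
  rw [mem_spectrum_iff, aeval_ofReal, Complex.ofReal_eq_zero]

/-- A zero of `D_a` would annihilate one of the strictly positive expressions of `IsOscillating`. -/
theorem aeval_endPoly_ne_zero (hz : 0 < z.im) (a : Fin 3) : aeval z (S.endPoly a) ≠ 0 := by
  intro h
  have ho := (S.isTransfer_complex z).isOscillating_succ zero_le_one hz S.n
  have hre : (aeval z (S.poly (S.n + 1) a)).re = 0 := by simpa [endPoly] using congrArg Complex.re h
  have him : (aeval z (S.poly (S.n + 1) a)).im = 0 := by simpa [endPoly] using congrArg Complex.im h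
  obtain rfl | rfl | rfl : a = 0 ∨ a = 1 ∨ a = 2 := by fin_cases a <;> simp
  · simpa [hre, him] using ho.zim01
  · simpa [hre, him] using ho.zim01
  · simpa [hre, him] using ho.zim12

theorem exists_pos_of_mem_spectrum {a : Fin 3} (hz : z ∈ S.spectrum a) :
    ∃ x : ℝ, 0 < x ∧ z = x := by
  rw [mem_spectrum_iff] at hz
  have him : z.im = 0 := by
    rcases lt_trichotomy z.im 0 with h | h | h
    · refine absurd ?_ (S.aeval_endPoly_ne_zero (z := (starRingEnd ℂ) z) (by simpa using h) a)
      rw [aeval_conj, hz, map_zero]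
    · exact h
    · exact absurd hz (S.aeval_endPoly_ne_zero h a)
  have hre : z = (z.re : ℂ) := Complex.ext rfl (by simpa using him)
  refine ⟨z.re, ?_, hre⟩
  rw [hre, aeval_ofReal, Complex.ofReal_eq_zero] at hz
  by_contra! h
  exact (S.eval_poly_succ_pos h S.n a).ne' hz

theorem n_pos_of_mem_spectrum {a : Fin 3} (hz : z ∈ S.spectrum a) : 0 < S.n := by
  obtain ⟨x, hx, rfl⟩ := exists_pos_of_mem_spectrum hz
  rw [ofReal_mem_spectrum_iff] at hz
  by_contra! h
  have h0 : S.n = 0 := by omega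
  have hw : S.weight 0 = 0 := h0 ▸ S.weight_last
  have hg := S.gap_zero_pos.ne'
  rw [endPoly, h0] at hz
  fin_cases a <;> simp [poly, hw, hg] at hz

/-- At a zero of one `D_a` a single product survives in each Wronskian involving it. This gives both
the simplicity of the zero and the signs of the residues. -/
theorem wronskian_endPoly_pos (hn : 0 < S.n) (x : ℝ) :
    (S.Nondegenerate → 0 < (derivative (S.endPoly 0)).eval x * (S.endPoly 1).eval x
      - (S.endPoly 0).eval x * (derivative (S.endPoly 1)).eval x) ∧
    0 < (derivative (S.endPoly 0)).eval x * (S.endPoly 2).eval x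
      - (S.endPoly 0).eval x * (derivative (S.endPoly 2)).eval x ∧
    0 < (derivative (S.endPoly 1)).eval x * (S.endPoly 2).eval x
      - (S.endPoly 1).eval x * (derivative (S.endPoly 2)).eval x :=
  ⟨(S.isTransfer_derivative x).im01_pos le_rfl one_pos hn,
    (S.isTransfer_derivative x).im12_pos le_rfl one_pos hn S.n⟩

theorem eval_derivative_endPoly_ne_zero {a : Fin 3} {x : ℝ} (hx : (x : ℂ) ∈ S.spectrum a) :
    (derivative (S.endPoly a)).eval x ≠ 0 := by
  obtain ⟨-, h1, h2⟩ := S.wronskian_endPoly_pos (n_pos_of_mem_spectrum hx) x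
  rw [ofReal_mem_spectrum_iff] at hx
  intro h
  fin_cases a
  · simp_all
  · simp_all
  · simp_all

theorem endPoly_ne_zero (a : Fin 3) : S.endPoly a ≠ 0 := by
  intro h
  have := S.eval_poly_succ_pos (x := 0) le_rfl S.n a
  rw [← endPoly, h, eval_zero] at this
  exact this.false

theorem spectrum_eq_roots (a : Fin 3) :
    S.spectrum a = (((S.endPoly a).map (algebraMap ℝ ℂ)).roots.toFinset : Set ℂ) := by
  ext z
  have h : (S.endPoly a).map (algebraMap ℝ ℂ) ≠ 0 := by simpa using S.endPoly_ne_zero a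
  simp [mem_spectrum_iff, h, aeval_def]

theorem finite_spectrum (a : Fin 3) : (S.spectrum a).Finite := by
  rw [spectrum_eq_roots]
  exact Finset.finite_toSet _

theorem ncard_spectrum {a : Fin 3} (ha : S.Nondegenerate ∨ a = 2) :
    (S.spectrum a).ncard = S.n := by
  classical
  have hne : (S.endPoly a).map (algebraMap ℝ ℂ) ≠ 0 := by simpa using S.endPoly_ne_zero a
  have hnd : ((S.endPoly a).map (algebraMap ℝ ℂ)).roots.Nodup := by
    refine Multiset.nodup_iff_count_le_one.2 fun z => ?_
    rw [count_roots]
    by_contra! h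
    rw [one_lt_rootMultiplicity_iff_isRoot hne] at h
    have hz : z ∈ S.spectrum a := by simpa [mem_spectrum_iff, aeval_def] using h.1
    obtain ⟨x, -, rfl⟩ := exists_pos_of_mem_spectrum hz
    refine eval_derivative_endPoly_ne_zero hz ?_
    have := h.2
    rw [IsRoot.def, derivative_map, eval_map_algebraMap, aeval_ofReal] at this
    exact_mod_cast this
  rw [spectrum_eq_roots, Set.ncard_coe_finset, Multiset.toFinset_card_of_nodup hnd,
    IsAlgClosed.card_roots_eq_natDegree, natDegree_map, natDegree_endPoly ha]

variable (S) in
/-- The real points of the spectrum of type `a`. -/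
abbrev Eigenvalue (a : Fin 3) : Type := {x : ℝ // (x : ℂ) ∈ S.spectrum a}

instance (a : Fin 3) : Finite (S.Eigenvalue a) :=
  Finite.of_injective (β := (S.finite_spectrum a).toFinset) (fun x => ⟨x.1, by simp [x.2]⟩)
    fun x y h => by simpa [Subtype.ext_iff] using h

noncomputable instance (a : Fin 3) : Fintype (S.Eigenvalue a) := Fintype.ofFinite _

theorem card_eigenvalue {a : Fin 3} (ha : S.Nondegenerate ∨ a = 2) :
    Fintype.card (S.Eigenvalue a) = S.n := by
  rw [← ncard_spectrum ha, ← Nat.card_eq_fintype_card, ← Nat.card_coe_set_eq]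
  refine Nat.card_congr (Equiv.ofBijective (fun x => ⟨x.1, x.2⟩) ⟨fun x y h => ?_, fun z => ?_⟩)
  · simpa [Subtype.ext_iff] using h
  · obtain ⟨z, hz⟩ := z
    obtain ⟨x, -, rfl⟩ := exists_pos_of_mem_spectrum hz
    exact ⟨⟨x, hz⟩, rfl⟩

/-! ### Residues and spectral measures -/

theorem tendsto_residue {a : Fin 3} {x : ℝ} (hx : (x : ℂ) ∈ S.spectrum a) {p : ℝ[X]} {M : ℂ → ℂ}
    (hM : ∀ w, M w = aeval w p / aeval w (S.endPoly a)) :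
    Tendsto (fun w => (w - x) * M w) (𝓝[≠] (x : ℂ))
      (𝓝 ((p.eval x / (derivative (S.endPoly a)).eval x : ℝ) : ℂ)) := by
  have h0 := mem_spectrum_iff.1 hx
  have hd : aeval (x : ℂ) (derivative (S.endPoly a)) ≠ 0 := by
    rw [aeval_ofReal]
    exact_mod_cast eval_derivative_endPoly_ne_zero hx
  have h1 := (((S.endPoly a).hasDerivAt_aeval (x : ℂ)).tendsto_slope).inv₀ hd
  have h2 : Tendsto (fun w : ℂ => aeval w p) (𝓝[≠] (x : ℂ)) (𝓝 (aeval (x : ℂ) p)) :=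
    (p.continuous_aeval.tendsto _).mono_left nhdsWithin_le_nhds
  have h3 := h2.mul h1
  rw [aeval_ofReal, aeval_ofReal, ← div_eq_mul_inv, ← Complex.ofReal_div] at h3
  refine h3.congr fun w => ?_
  rw [hM, slope_def_field, h0, sub_zero, inv_div]
  ring

theorem residue_eq {a : Fin 3} {x : ℝ} (hx : (x : ℂ) ∈ S.spectrum a) {p : ℝ[X]} {M : ℂ → ℂ}
    (hM : ∀ w, M w = aeval w p / aeval w (S.endPoly a)) :
    residue M x = ((p.eval x / (derivative (S.endPoly a)).eval x : ℝ) : ℂ) :=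
  (tendsto_residue hx hM).limUnder_eq

theorem positiveSimplePoles {a : Fin 3} {p : ℝ[X]} {M : ℂ → ℂ}
    (hM : ∀ w, M w = aeval w p / aeval w (S.endPoly a))
    (hp : ∀ x : S.Eigenvalue a, 0 < p.eval x.1 / (derivative (S.endPoly a)).eval x.1) :
    S.PositiveSimplePoles a M := by
  refine ⟨S.finite_spectrum a, fun z hz => ?_⟩
  obtain ⟨x, hx, rfl⟩ := exists_pos_of_mem_spectrum hz
  exact ⟨x, _, hx, hp ⟨x, hz⟩, rfl, tendsto_residue hz hM⟩

theorem integral_spectralMeasure {a : Fin 3} {p : ℝ[X]} {M : ℂ → ℂ}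
    (hM : ∀ w, M w = aeval w p / aeval w (S.endPoly a))
    (hp : ∀ x : S.Eigenvalue a, 0 < p.eval x.1 / (derivative (S.endPoly a)).eval x.1)
    (f : ℝ → ℂ) :
    ∫ x, f x ∂S.spectralMeasure a M = ∑ x : S.Eigenvalue a,
      ((p.eval x.1 / (derivative (S.endPoly a)).eval x.1 : ℝ) : ℂ) * f x.1 := by
  rw [spectralMeasure, Measure.sum_fintype, integral_finsetSum_measure]
  · refine Finset.sum_congr rfl fun x _ => ?_
    rw [integral_smul_measure, integral_dirac, residue_eq x.2 hM, Complex.ofReal_re,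
      ENNReal.toReal_ofReal (hp x).le]
    simp
  · intro i _
    exact (integrable_dirac (by simp)).smul_measure ENNReal.ofReal_ne_top

/-! ### Biorthogonality and completeness -/

theorem concomitant_phi_phi (z w : ℂ) :
    (z + w) * ∑ i, S.wt i * (S.phi z 0 (S.pos i) * S.phi w 0 (S.pos i))
      = -concomitant (S.phi z) (S.phi w) 1 := by
  have h := (S.phi_spec z).1.lagrange (S.phi_spec w).1
  have hz := (S.phi_spec z).2
  have hw := (S.phi_spec w).2
  have h0 : concomitant (S.phi z) (S.phi w) 0 = 0 := by simp [concomitant, hz, hw]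
  rw [h0] at h
  linear_combination h

/-- The data of `φ*_a` at `1` select `(-1)^a D_a(z)` from the concomitant. Its value at `0` is
`φ*_a(0; w)`, independent of `z`, and is found by setting `z = w`. -/
theorem concomitant_phi_phiStar (a : Fin 3) (z w : ℂ) :
    (w - z) * ∑ i, S.wt i * (S.phi z 0 (S.pos i) * S.phiStar a w 0 (S.pos i))
      = (-1) ^ (a : ℕ) * (aeval z (S.endPoly a) - aeval w (S.endPoly a)) := by
  have h1 : ∀ z, concomitant (S.phi z) (S.phiStar a w) 1
      = (-1) ^ (a : ℕ) * aeval z (S.endPoly a) := fun z => by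
    have hw := (S.phiStar_spec a w).2
    obtain rfl | rfl | rfl : a = 0 ∨ a = 1 ∨ a = 2 := by fin_cases a <;> simp
    all_goals simp [concomitant, hw, adjointValue, phi_one]
  have h0 : ∀ z, concomitant (S.phi z) (S.phiStar a w) 0 = S.phiStar a w 0 0 := fun z => by
    have hz := (S.phi_spec z).2
    simp [concomitant, hz]
  have hz := (S.phi_spec z).1.lagrange (S.phiStar_spec a w).1
  have hw := (S.phi_spec w).1.lagrange (S.phiStar_spec a w).1
  rw [h1, h0] at hz hw
  linear_combination hw - hz

/-- The diagonal case, where `concomitant_phi_phiStar` reads `0 = 0`. With `w` fixed it is an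
identity of polynomials in `z`, and its derivative at `z = w` gives the norming constant. -/
theorem sum_phi_mul_phiStar_self (a : Fin 3) (w : ℂ) :
    ∑ i, S.wt i * (S.phi w 0 (S.pos i) * S.phiStar a w 0 (S.pos i))
      = -((-1) ^ (a : ℕ) * aeval w (derivative (S.endPoly a))) := by
  set Q : ℂ[X] := ∑ i : Fin S.n, C (S.wt i * S.phiStar a w 0 (S.pos i))
    * (S.poly (i + 1) 0).map (algebraMap ℝ ℂ) with hQ
  have hQe : ∀ z, Q.eval z
      = ∑ i, S.wt i * (S.phi z 0 (S.pos i) * S.phiStar a w 0 (S.pos i)) := fun z => by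
    rw [hQ, eval_finsetSum]
    refine Finset.sum_congr rfl fun i _ => ?_
    rw [eval_mul, eval_C, eval_map_algebraMap, phi_pos]
    ring
  have hpoly : (C w - X) * Q = C ((-1) ^ (a : ℕ)) *
      ((S.endPoly a).map (algebraMap ℝ ℂ) - C (aeval w (S.endPoly a))) := by
    refine Polynomial.funext fun z => ?_
    rw [eval_mul, hQe, eval_sub, eval_C, eval_X, concomitant_phi_phiStar, eval_mul, eval_sub,
      eval_C, eval_C, eval_map_algebraMap]
  have h := congrArg (fun p => p.derivative.eval w) hpoly
  simp only [derivative_mul, derivative_sub, derivative_C, derivative_X, eval_add, eval_sub,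
    eval_mul, eval_C, eval_X, derivative_map, eval_map_algebraMap, hQe, sub_self, zero_mul,
    add_zero, zero_add, sub_zero, zero_sub, eval_neg, eval_one] at h
  linear_combination -h

theorem fourier_eq (a : Fin 3) (f : ℝ → ℂ) (z : ℂ) : S.fourier a f z
    = (-1) ^ (a : ℕ) * ∑ i, S.wt i * (S.phiStar a z 0 (S.pos i) * f (S.pos i)) := by
  rw [fourier, integral_mass]

/-- Expansion in eigenfunctions of type `a`. -/
theorem eq_sum_fourier {a : Fin 3} (ha : S.Nondegenerate ∨ a = 2) (f : ℝ → ℂ) (j : Fin S.n) :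
    f (S.pos j) = -∑ x : S.Eigenvalue a, S.fourier a f x.1
      / aeval (x.1 : ℂ) (derivative (S.endPoly a)) * S.phi x.1 0 (S.pos j) := by
  have hd : ∀ x : S.Eigenvalue a, aeval (x.1 : ℂ) (derivative (S.endPoly a)) ≠ 0 := fun x => by
    rw [aeval_ofReal]
    exact_mod_cast eval_derivative_endPoly_ne_zero x.2
  have hsign : ((-1 : ℂ) ^ (a : ℕ)) * (-1) ^ (a : ℕ) = 1 := by
    rw [← mul_pow]; simp
  let U : Matrix (S.Eigenvalue a) (Fin S.n) ℂ := fun x i => S.phi x.1 0 (S.pos i)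
  let V : Matrix (Fin S.n) (S.Eigenvalue a) ℂ := fun i x =>
    -((-1) ^ (a : ℕ) * (S.wt i * S.phiStar a x.1 0 (S.pos i))
      / aeval (x.1 : ℂ) (derivative (S.endPoly a)))
  have hUV : U * V = 1 := by
    ext x y
    have hsum : (U * V) x y = -((-1) ^ (a : ℕ) / aeval (y.1 : ℂ) (derivative (S.endPoly a))
        * ∑ i, S.wt i * (S.phi x.1 0 (S.pos i) * S.phiStar a y.1 0 (S.pos i))) := by
      rw [Matrix.mul_apply]
      simp only [U, V, Finset.mul_sum, ← Finset.sum_neg_distrib]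
      exact Finset.sum_congr rfl fun i _ => by ring
    rw [hsum]
    by_cases hxy : x = y
    · subst hxy
      rw [sum_phi_mul_phiStar_self, Matrix.one_apply_eq]
      have := hd x
      field_simp
      linear_combination hsign
    · have h := S.concomitant_phi_phiStar a x.1 y.1
      rw [mem_spectrum_iff.1 x.2, mem_spectrum_iff.1 y.2, sub_zero, mul_zero] at h
      have hne : (y.1 : ℂ) - x.1 ≠ 0 := by
        rw [sub_ne_zero]
        exact fun h => hxy (Subtype.ext (Complex.ofReal_injective h.symm))
      rw [(mul_eq_zero.1 h).resolve_left hne, Matrix.one_apply_ne hxy]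
      simp
  have hVU : V * U = 1 :=
    -- Completeness: there are as many eigenvalues as masses, so a one-sided inverse is two-sided.
    (Matrix.mul_eq_one_comm_of_card_eq _ _ _ (by rw [card_eigenvalue ha, Fintype.card_fin])).1 hUV
  have hf : f (S.pos j) = ∑ i, f (S.pos i) * (V * U) i j := by
    rw [hVU]
    simp [Matrix.one_apply]
  rw [hf]
  simp only [Matrix.mul_apply, Finset.mul_sum]
  rw [Finset.sum_comm, ← Finset.sum_neg_distrib]
  refine Finset.sum_congr rfl fun x _ => ?_
  rw [fourier_eq, Finset.mul_sum, Finset.sum_div, Finset.sum_mul, ← Finset.sum_neg_distrib]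
  refine Finset.sum_congr rfl fun i _ => ?_
  simp only [U, V]
  ring

/-- The two arguments are expanded in eigenfunctions of different types; the minus signs of the
expansions cancel, and `x + y ≠ 0` because eigenvalues are positive. -/
theorem form_eq {a b : Fin 3} (ha : S.Nondegenerate ∨ a = 2) (hb : S.Nondegenerate ∨ b = 2)
    (f h : ℝ → ℂ) :
    S.form f h = ∑ x : S.Eigenvalue a, ∑ y : S.Eigenvalue b,
      S.fourier a f x.1 / aeval (x.1 : ℂ) (derivative (S.endPoly a))
        * (S.fourier b h y.1 / aeval (y.1 : ℂ) (derivative (S.endPoly b)))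
        * (-concomitant (S.phi x.1) (S.phi y.1) 1 / (x.1 + y.1)) := by
  rw [form, integral_mass]
  have key : ∀ (x : S.Eigenvalue a) (y : S.Eigenvalue b),
      -concomitant (S.phi x.1) (S.phi y.1) 1 / (x.1 + y.1)
        = ∑ i, S.wt i * (S.phi x.1 0 (S.pos i) * S.phi y.1 0 (S.pos i)) := fun x y => by
    obtain ⟨u, hu, hxu⟩ := exists_pos_of_mem_spectrum x.2
    obtain ⟨v, hv, hyv⟩ := exists_pos_of_mem_spectrum y.2
    have hne : (x.1 : ℂ) + y.1 ≠ 0 := by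
      rw [hxu, hyv]
      exact_mod_cast (add_pos hu hv).ne'
    rw [← concomitant_phi_phi, mul_div_cancel_left₀ _ hne]
  simp only [key]
  rw [Finset.sum_congr rfl fun i _ => by
    rw [eq_sum_fourier ha f i, eq_sum_fourier hb h i, neg_mul_neg, Finset.sum_mul_sum,
      Finset.mul_sum]]
  simp only [Finset.mul_sum]
  rw [Finset.sum_comm]
  refine Finset.sum_congr rfl fun x _ => ?_
  rw [Finset.sum_comm]
  refine Finset.sum_congr rfl fun y _ => Finset.sum_congr rfl fun i _ => ?_
  ring

theorem form_comm (f h : ℝ → ℂ) : S.form f h = S.form h f := by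
  simp only [form, mul_comm]

end DiscreteCubicString

/-! ### Factorization of the boundary term and the Parseval identity -/

namespace FactorizingPair

open Polynomial DiscreteCubicString

/-- The numerator of the first Weyl function. -/
noncomputable def fstNum (S : DiscreteCubicString) : FactorizingPair → ℝ[X]
  | type00 => S.endPoly 1
  | type01 => S.endPoly 2
  | type12 => S.endPoly 2
  | type22 => -S.endPoly 1

/-- The numerator of the second Weyl function. -/
noncomputable def sndNum (S : DiscreteCubicString) : FactorizingPair → ℝ[X]
  | type00 => S.endPoly 1
  | type01 => -S.endPoly 0
  | type12 => -S.endPoly 0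
  | type22 => -S.endPoly 1

variable {S : DiscreteCubicString} (P : FactorizingPair)

theorem fstWeyl_eq (w : ℂ) :
    P.fstWeyl S w = aeval w (P.fstNum S) / aeval w (S.endPoly P.fst) := by
  cases P <;> simp [fstWeyl, fstNum, fst, weylW, weylZ, phi_one, neg_div]

theorem sndWeyl_eq (w : ℂ) :
    P.sndWeyl S w = aeval w (P.sndNum S) / aeval w (S.endPoly P.snd) := by
  cases P <;> simp [sndWeyl, sndNum, snd, weylW, weylZ, phi_one, neg_div]

theorem fst_residue_pos (hSP : S.Nondegenerate ∨ P = type22) (x : S.Eigenvalue P.fst) :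
    0 < (P.fstNum S).eval x.1 / (derivative (S.endPoly P.fst)).eval x.1 := by
  obtain ⟨h01, h02, h12⟩ := S.wronskian_endPoly_pos (n_pos_of_mem_spectrum x.2) x.1
  have h0 := ofReal_mem_spectrum_iff.1 x.2
  rw [div_pos_iff, ← mul_pos_iff]
  cases P <;> simp_all [fst, fstNum] <;> linarith

theorem snd_residue_pos (hSP : S.Nondegenerate ∨ P = type22) (y : S.Eigenvalue P.snd) :
    0 < (P.sndNum S).eval y.1 / (derivative (S.endPoly P.snd)).eval y.1 := by
  obtain ⟨h01, h02, h12⟩ := S.wronskian_endPoly_pos (n_pos_of_mem_spectrum y.2) y.1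
  have h0 := ofReal_mem_spectrum_iff.1 y.2
  rw [div_pos_iff, ← mul_pos_iff]
  cases P <;> simp_all [snd, sndNum] <;> linarith

/-- The boundary conditions `D_a(x) = 0` and `D_b(y) = 0` kill two of the three summands: `D_1(x)
D_1(y)` remains for equal types, `-D_2(x) D_0(y)` for the mixed ones. -/
theorem neg_concomitant_eq (x : S.Eigenvalue P.fst) (y : S.Eigenvalue P.snd) :
    -concomitant (S.phi x.1) (S.phi y.1) 1
      = aeval (x.1 : ℂ) (P.fstNum S) * aeval (y.1 : ℂ) (P.sndNum S) := by
  have hx := mem_spectrum_iff.1 x.2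
  have hy := mem_spectrum_iff.1 y.2
  cases P <;> simp_all [fst, snd, fstNum, sndNum, concomitant, phi_one]

theorem form_eq_cauchyPairing (hSP : S.Nondegenerate ∨ P = type22) (f h : ℝ → ℂ) :
    S.form f h = cauchyPairing (P.alpha S) (P.beta S)
      (fun x => S.fourier P.fst f x) (fun y => S.fourier P.snd h y) := by
  have ha : S.Nondegenerate ∨ P.fst = 2 := hSP.imp_right fun h => by rw [h]; rfl
  have hb : S.Nondegenerate ∨ P.snd = 2 := hSP.imp_right fun h => by rw [h]; rfl
  rw [form_eq ha hb, cauchyPairing, alpha, beta,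
    integral_spectralMeasure P.fstWeyl_eq (P.fst_residue_pos hSP)]
  refine Finset.sum_congr rfl fun x _ => ?_
  rw [integral_spectralMeasure P.sndWeyl_eq (P.snd_residue_pos hSP), Finset.mul_sum]
  refine Finset.sum_congr rfl fun y _ => ?_
  rw [neg_concomitant_eq, Complex.ofReal_div, Complex.ofReal_div]
  simp only [aeval_ofReal]
  ring

end FactorizingPair

theorem mainTheorem1 (S : DiscreteCubicString) (P : FactorizingPair)
    (hSP : S.Nondegenerate ∨ P = FactorizingPair.type22) :
    S.PositiveSimplePoles P.fst (P.fstWeyl S) ∧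
    S.PositiveSimplePoles P.snd (P.sndWeyl S) ∧
    ∀ f h : Lp ℂ 2 S.mass,
      S.form f h = cauchyPairing (P.alpha S) (P.beta S)
          (fun x => S.fourier P.fst f x) (fun y => S.fourier P.snd h y) ∧
      S.form f h = cauchyPairing (P.alpha S) (P.beta S)
          (fun x => S.fourier P.fst h x) (fun y => S.fourier P.snd f y) := by
  refine ⟨DiscreteCubicString.positiveSimplePoles P.fstWeyl_eq (P.fst_residue_pos hSP),
    DiscreteCubicString.positiveSimplePoles P.sndWeyl_eq (P.snd_residue_pos hSP),
    fun f h => ⟨P.form_eq_cauchyPairing hSP f h, ?_⟩⟩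
  -- The form is symmetric, so the first identity with `f` and `h` exchanged is the second one.
  rw [DiscreteCubicString.form_comm]
  exact P.form_eq_cauchyPairing hSP h f
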